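/- Let $k$ be a field of characteristic $0$ and let $L$ be a finite-dimensional left Leibniz algebra over $k$, i.e. a finite-dimensional $k$-vector space with a bilinear bracket satisfying $[x,[y,z]]=[[x,y],z]+[y,[x,z]]$ for all $x,y,z\in L$. Let $Z^l(L)=\{x\in L : [x,L]=0\}$ be its left center; it is a two-sided ideal of $L$, and $L/Z^l(L)$ is a Lie algebra. Suppose that the left center lies in the right center $Z^r(L)=\{x\in L : [L,x]=0\}$, i.e. that $[L,Z^l(L)]=0$, and that the Lie algebra $L/Z^l(L)$ is semisimple (has no nonzero solvable ideals). Then $L$ is a Lie algebra (i.e. $[x,x]=0$ for all $x\in L$), and it is reductive, i.e. the direct sum of a semisimple ideal and an abelian ideal; in particular, its radical (largest solvable ideal) is central, i.e. equal to the center of $L$. -/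

import Mathlib

/-- A (left) Leibniz ring: an additive group with a biadditive bracket such that every left
multiplication `⁅x, ·⁆` is a derivation of the bracket. -/
class LeftLeibnizRing (L : Type*) extends AddCommGroup L, Bracket L L where
  protected add_lie : ∀ x y z : L, ⁅x + y, z⁆ = ⁅x, z⁆ + ⁅y, z⁆
  protected lie_add : ∀ x y z : L, ⁅x, y + z⁆ = ⁅x, y⁆ + ⁅x, z⁆
  protected leibniz_lie : ∀ x y z : L, ⁅x, ⁅y, z⁆⁆ = ⁅⁅x, y⁆, z⁆ + ⁅y, ⁅x, z⁆⁆

/-- A (left) Leibniz algebra over `k`: a left Leibniz ring with a `k`-module structure for which the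
bracket is `k`-bilinear. -/
class LeftLeibnizAlgebra (k L : Type*) [CommRing k] [LeftLeibnizRing L] extends Module k L where
  protected smul_lie : ∀ (t : k) (x y : L), ⁅t • x, y⁆ = t • ⁅x, y⁆
  protected lie_smul : ∀ (t : k) (x y : L), ⁅x, t • y⁆ = t • ⁅x, y⁆

namespace LeftLeibniz

section Ring

variable {L : Type*} [LeftLeibnizRing L]

theorem zero_bracket (y : L) : ⁅(0 : L), y⁆ = 0 := by
  have h := LeftLeibnizRing.add_lie (0 : L) 0 y
  rw [add_zero] at h
  exact left_eq_add.mp h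

theorem bracket_zero (x : L) : ⁅x, (0 : L)⁆ = 0 := by
  have h := LeftLeibnizRing.lie_add x (0 : L) 0
  rw [add_zero] at h
  exact left_eq_add.mp h

theorem neg_bracket (x y : L) : ⁅-x, y⁆ = -⁅x, y⁆ := by
  have h := LeftLeibnizRing.add_lie (-x) x y
  rw [neg_add_cancel, zero_bracket] at h
  exact eq_neg_of_add_eq_zero_left h.symm

theorem bracket_neg (x y : L) : ⁅x, -y⁆ = -⁅x, y⁆ := by
  have h := LeftLeibnizRing.lie_add x (-y) y
  rw [neg_add_cancel, bracket_zero] at h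
  exact eq_neg_of_add_eq_zero_left h.symm

theorem self_bracket_bracket (x z : L) : ⁅⁅x, x⁆, z⁆ = 0 :=
  right_eq_add.mp (LeftLeibnizRing.leibniz_lie x x z)

end Ring

section Center

variable (k L : Type*) [CommRing k] [LeftLeibnizRing L] [LeftLeibnizAlgebra k L]

/-- The left center `Z^l(L) = {x ∈ L | [x, L] = 0}`. -/
def leftCenter : Submodule k L where
  carrier := {x | ∀ y : L, ⁅x, y⁆ = 0}
  zero_mem' := zero_bracket
  add_mem' {a b} ha hb y := by rw [LeftLeibnizRing.add_lie, ha y, hb y, add_zero]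
  smul_mem' t a ha y := by rw [LeftLeibnizAlgebra.smul_lie, ha y, smul_zero]

/-- The right center `Z^r(L) = {x ∈ L | [L, x] = 0}`. -/
def rightCenter : Submodule k L where
  carrier := {x | ∀ y : L, ⁅y, x⁆ = 0}
  zero_mem' := bracket_zero
  add_mem' {a b} ha hb y := by rw [LeftLeibnizRing.lie_add, ha y, hb y, add_zero]
  smul_mem' t a ha y := by rw [LeftLeibnizAlgebra.lie_smul, ha y, smul_zero]

variable {k L}

theorem mem_leftCenter {x : L} : x ∈ leftCenter k L ↔ ∀ y : L, ⁅x, y⁆ = 0 := Iff.rfl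

theorem mem_rightCenter {x : L} : x ∈ rightCenter k L ↔ ∀ y : L, ⁅y, x⁆ = 0 := Iff.rfl

/-- The left center is a left ideal. -/
theorem bracket_mem_leftCenter (y : L) {x : L} (hx : x ∈ leftCenter k L) :
    ⁅y, x⁆ ∈ leftCenter k L := by
  intro z
  have h := LeftLeibnizRing.leibniz_lie y x z
  rw [hx z, hx ⁅y, z⁆, bracket_zero, add_zero] at h
  exact h.symm

/-- The left center contains all squares. -/
theorem self_bracket_mem_leftCenter (x : L) : ⁅x, x⁆ ∈ leftCenter k L :=
  self_bracket_bracket x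

/-- The bracket induced on the quotient of a left Leibniz algebra by its left center. -/
instance : Bracket (L ⧸ leftCenter k L) (L ⧸ leftCenter k L) where
  bracket := Quotient.map₂ (fun x y : L => ⁅x, y⁆) (by
    intro x₁ x₂ hx y₁ y₂ hy
    change (Submodule.quotientRel (leftCenter k L)) _ _ at hx
    change (Submodule.quotientRel (leftCenter k L)) _ _ at hy
    change (Submodule.quotientRel (leftCenter k L)) _ _
    rw [Submodule.quotientRel_def] at hx hy ⊢
    have h₁ : ⁅x₁, y₁⁆ = ⁅x₂, y₁⁆ := by
      have h := hx y₁
      rw [sub_eq_add_neg, LeftLeibnizRing.add_lie, neg_bracket] at h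
      exact add_neg_eq_zero.mp h
    have h₂ : ⁅x₂, y₁⁆ - ⁅x₂, y₂⁆ = ⁅x₂, y₁ - y₂⁆ := by
      rw [sub_eq_add_neg, sub_eq_add_neg, LeftLeibnizRing.lie_add, bracket_neg]
    rw [h₁, h₂]
    exact bracket_mem_leftCenter x₂ hy)

theorem mk_bracket (x y : L) :
    (Submodule.Quotient.mk ⁅x, y⁆ : L ⧸ leftCenter k L) =
      ⁅(Submodule.Quotient.mk x : L ⧸ leftCenter k L), (Submodule.Quotient.mk y : L ⧸ leftCenter k L)⁆ :=
  rfl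

/-- The quotient of a left Leibniz algebra by its left center is a Lie ring. -/
instance : LieRing (L ⧸ leftCenter k L) where
  add_lie x y z := by
    induction x using Submodule.Quotient.induction_on with | _ x
    induction y using Submodule.Quotient.induction_on with | _ y
    induction z using Submodule.Quotient.induction_on with | _ z
    simp only [← Submodule.Quotient.mk_add, ← mk_bracket, LeftLeibnizRing.add_lie]
  lie_add x y z := by
    induction x using Submodule.Quotient.induction_on with | _ x
    induction y using Submodule.Quotient.induction_on with | _ y
    induction z using Submodule.Quotient.induction_on with | _ z
    simp only [← Submodule.Quotient.mk_add, ← mk_bracket, LeftLeibnizRing.lie_add]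
  lie_self x := by
    induction x using Submodule.Quotient.induction_on with | _ x
    rw [← mk_bracket, Submodule.Quotient.mk_eq_zero]
    exact self_bracket_mem_leftCenter x
  leibniz_lie x y z := by
    induction x using Submodule.Quotient.induction_on with | _ x
    induction y using Submodule.Quotient.induction_on with | _ y
    induction z using Submodule.Quotient.induction_on with | _ z
    simp only [← mk_bracket, ← Submodule.Quotient.mk_add]
    exact congrArg _ (LeftLeibnizRing.leibniz_lie x y z)

/-- The quotient of a left Leibniz algebra by its left center is a Lie algebra. -/
instance : LieAlgebra k (L ⧸ leftCenter k L) where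
  lie_smul t x y := by
    induction x using Submodule.Quotient.induction_on with | _ x
    induction y using Submodule.Quotient.induction_on with | _ y
    simp only [← Submodule.Quotient.mk_smul, ← mk_bracket, LeftLeibnizAlgebra.lie_smul]

end Center

section IsLie

/-- A left Leibniz algebra is a Lie algebra if its bracket is alternating (the Leibniz identity then
is the Jacobi identity). -/
def IsLie (L : Type*) [LeftLeibnizRing L] : Prop := ∀ x : L, ⁅x, x⁆ = 0

/-- The Lie ring with the same underlying addition and bracket. -/
@[reducible] def IsLie.toLieRing {L : Type*} [inst : LeftLeibnizRing L] (h : IsLie L) : LieRing L where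
  toAddCommGroup := inst.toAddCommGroup
  toBracket := inst.toBracket
  add_lie := LeftLeibnizRing.add_lie
  lie_add := LeftLeibnizRing.lie_add
  lie_self := h
  leibniz_lie := LeftLeibnizRing.leibniz_lie

/-- The Lie algebra with the same underlying vector space and bracket. -/
@[reducible] def IsLie.toLieAlgebra (k : Type*) {L : Type*} [CommRing k] [LeftLeibnizRing L]
    [inst : LeftLeibnizAlgebra k L] (h : IsLie L) : @LieAlgebra k L _ h.toLieRing :=
  letI := h.toLieRing
  { toModule := inst.toModule
    lie_smul := LeftLeibnizAlgebra.lie_smul }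

end IsLie

/-- A Lie algebra (finite-dimensional over a field of characteristic zero) is reductive if it is the
direct sum of a semisimple ideal and an abelian ideal. Here semisimple means: without nonzero solvable
ideals. -/
def IsReductive (k L : Type*) [CommRing k] [LieRing L] [LieAlgebra k L] : Prop :=
  ∃ S A : LieIdeal k L, IsCompl S A ∧ LieAlgebra.HasTrivialRadical k S ∧ IsLieAbelian A

end LeftLeibniz

/-! Write `Z` for the left center and `G = L ⧸ Z`. Left multiplication makes `L` a `G`-module,
trivial on `Z` because `Z` is right central, and the quotient map to the adjoint module `G` is
equivariant. In characteristic zero `G` has nondegenerate Killing form; let `C` be the action of its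
Casimir element on `L`. It is equivariant (`lie_casimir`), kills `Z`, and induces the identity on
`G` (`casimir_adjoint`), so it is an equivariant projection along `Z`, obtained without Weyl's
theorem.

As `x - C x` is right central, `[x,x] = [x, C x] = C [x,x]`, which vanishes because squares lie in
`Z`. So `L` is Lie, and the range of `C` is an ideal complementary to the central ideal `Z` and
isomorphic to `G`. -/

namespace LeftLeibniz

/-! ### The Casimir operator of the Killing form. -/

section Casimir

open LieAlgebra LieModule

variable {K G M N ι : Type*} [Field K] [LieRing G] [LieAlgebra K G] [IsKilling K G]
  [AddCommGroup M] [Module K M] [LieRingModule G M] [LieModule K G M]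
  [AddCommGroup N] [Module K N] [LieRingModule G N] [LieModule K G N]
  [Fintype ι] [DecidableEq ι]

/-- The basis dual to a given one with respect to the Killing form. -/
noncomputable def killingDual (b : Module.Basis ι K G) : Module.Basis ι K G :=
  LinearMap.BilinForm.dualBasis (killingForm K G) (IsKilling.killingForm_nondegenerate K G) b

variable (M) in
/-- The action on a module of the Casimir element of the Killing form. -/
noncomputable def casimir (b : Module.Basis ι K G) : M →ₗ[K] M :=
  ∑ i, toEnd K G M (b i) ∘ₗ toEnd K G M (killingDual b i)

theorem casimir_apply (b : Module.Basis ι K G) (m : M) :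
    casimir M b m = ∑ i, ⁅b i, ⁅killingDual b i, m⁆⁆ := by
  simp [casimir]

theorem sum_killingForm_smul_killingDual (b : Module.Basis ι K G) (x : G) :
    ∑ i, killingForm K G x (b i) • killingDual b i = x := by
  conv_rhs => rw [← (killingDual b).sum_repr x]
  refine Finset.sum_congr rfl fun i _ => ?_
  rw [killingDual, LinearMap.BilinForm.dualBasis_repr_apply]

theorem killingDual_killingDual (b : Module.Basis ι K G) : killingDual (killingDual b) = b :=
  LinearMap.BilinForm.dualBasis_dualBasis _ ⟨traceForm_comm K G G⟩ b

theorem basis_repr_eq_killingForm (b : Module.Basis ι K G) (x : G) (i : ι) :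
    b.repr x i = killingForm K G x (killingDual b i) := by
  conv_lhs => rw [← killingDual_killingDual b]
  exact LinearMap.BilinForm.dualBasis_repr_apply ..

theorem sum_killingForm_smul_basis (b : Module.Basis ι K G) (x : G) :
    ∑ i, killingForm K G x (killingDual b i) • b i = x := by
  simpa only [killingDual_killingDual] using sum_killingForm_smul_killingDual (killingDual b) x

/-- The Casimir operator is equivariant. -/
theorem lie_casimir (b : Module.Basis ι K G) (y : G) (m : M) :
    ⁅y, casimir M b m⁆ = casimir M b ⁅y, m⁆ := by
  have h₁ (i : ι) : ⁅y, b i⁆ = ∑ j, killingForm K G ⁅y, b i⁆ (killingDual b j) • b j :=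
    (sum_killingForm_smul_basis b _).symm
  have h₂ (i : ι) : ⁅y, killingDual b i⁆ =
      -∑ j, killingForm K G ⁅y, b j⁆ (killingDual b i) • killingDual b j := by
    rw [← Finset.sum_neg_distrib]
    conv_lhs => rw [← sum_killingForm_smul_killingDual b ⁅y, killingDual b i⁆]
    refine Finset.sum_congr rfl fun j _ => ?_
    rw [← neg_smul, traceForm_apply_lie_apply', traceForm_comm]
  -- The matrices of `ad y` in the two dual bases are negative transposes of each other, so the two
  -- double sums cancel after exchanging indices.
  have h₃ : ∑ i, ⁅⁅y, b i⁆, ⁅killingDual b i, m⁆⁆ +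
      ∑ i, ⁅b i, ⁅⁅y, killingDual b i⁆, m⁆⁆ = 0 := by
    conv_lhs =>
      enter [1, 2, i]
      rw [h₁]
    conv_lhs =>
      enter [2, 2, i]
      rw [h₂]
    simp only [sum_lie, neg_lie, lie_neg, lie_sum, smul_lie, lie_smul, Finset.sum_neg_distrib]
    rw [Finset.sum_comm, add_neg_cancel]
  rw [casimir_apply, casimir_apply, lie_sum]
  calc ∑ i, ⁅y, ⁅b i, ⁅killingDual b i, m⁆⁆⁆
      = (∑ i, ⁅⁅y, b i⁆, ⁅killingDual b i, m⁆⁆ + ∑ i, ⁅b i, ⁅⁅y, killingDual b i⁆, m⁆⁆) +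
          ∑ i, ⁅b i, ⁅killingDual b i, ⁅y, m⁆⁆⁆ := by
        rw [← Finset.sum_add_distrib, ← Finset.sum_add_distrib]
        refine Finset.sum_congr rfl fun i _ => ?_
        rw [leibniz_lie y (b i), leibniz_lie y (killingDual b i), lie_add, add_assoc]
    _ = _ := by rw [h₃, zero_add]

theorem map_casimir (b : Module.Basis ι K G) (f : M →ₗ⁅K, G⁆ N) (m : M) :
    f (casimir M b m) = casimir N b (f m) := by
  simp [casimir_apply, map_sum]

/-- The Casimir operator of the Killing form is the identity on the adjoint module. -/
theorem casimir_adjoint (b : Module.Basis ι K G) (y : G) : casimir G b y = y := by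
  refine sub_eq_zero.mp ((IsKilling.killingForm_nondegenerate K G).1 _ fun z => ?_)
  rw [map_sub, LinearMap.sub_apply, sub_eq_zero]
  -- The trace of `ad y ∘ ad z` in the basis `b`, each diagonal entry being read off by pairing with
  -- the dual basis. Invariance of the form then turns each term into a term of the Casimir sum
  -- paired with `z`.
  have key : killingForm K G y z = ∑ i, killingForm K G ⁅y, ⁅z, b i⁆⁆ (killingDual b i) := by
    rw [killingForm_apply_apply, LinearMap.trace_eq_matrix_trace K b, Matrix.trace]
    refine Finset.sum_congr rfl fun i _ => ?_
    rw [Matrix.diag_apply, LinearMap.toMatrix_apply, basis_repr_eq_killingForm]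
    rfl
  rw [key, casimir_apply, map_sum, LinearMap.sum_apply]
  refine Finset.sum_congr rfl fun i _ => ?_
  rw [traceForm_apply_lie_apply', traceForm_apply_lie_apply', neg_neg,
    traceForm_apply_lie_apply K G G y, ← lie_skew z (b i), neg_lie, lie_skew]

end Casimir

/-! ### Split central extensions of semisimple Lie algebras. -/

section Complement

open LieAlgebra

variable {k L G : Type*} [Field k] [LieRing L] [LieAlgebra k L] [LieRing G] [LieAlgebra k G]

/-- An ideal complementary to the kernel of a surjection is isomorphic to the target. -/
noncomputable def equivOfIsComplKer (f : L →ₗ⁅k⁆ G) (hf : Function.Surjective f)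
    (S : LieIdeal k L) (h : IsCompl S f.ker) : S ≃ₗ⁅k⁆ G :=
  LieEquiv.ofBijective (f.comp S.incl) <| by
    constructor
    · refine (injective_iff_map_eq_zero _).mpr fun x hx => ?_
      have : (x : L) ∈ S ⊓ f.ker := ⟨x.2, hx⟩
      rw [h.inf_eq_bot] at this
      exact Subtype.ext this
    · intro y
      obtain ⟨x, rfl⟩ := hf y
      have hx : x ∈ S ⊔ f.ker := h.sup_eq_top ▸ LieSubmodule.mem_top x
      obtain ⟨s, hs, z, hz, rfl⟩ := (LieSubmodule.mem_sup _ _ _).mp hx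
      refine ⟨⟨s, hs⟩, ?_⟩
      rw [map_add, LieHom.mem_ker.mp hz, add_zero]
      rfl

/-- A surjection carries the radical onto a solvable ideal of `G`, which must vanish. -/
theorem radical_le_ker [HasTrivialRadical k G] [IsNoetherian k L] (f : L →ₗ⁅k⁆ G)
    (hf : Function.Surjective f) : radical k L ≤ f.ker := by
  rw [← LieIdeal.map_eq_bot_iff]
  let g : radical k L →ₗ⁅k⁆ LieIdeal.map f (radical k L) :=
    { toFun x := ⟨f x, LieIdeal.mem_map x.2⟩
      map_add' x y := Subtype.ext (map_add f _ _)
      map_smul' t x := Subtype.ext (map_smul f _ _)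
      map_lie' := Subtype.ext (LieHom.map_lie f _ _) }
  have hg : Function.Surjective g := by
    rintro ⟨y, hy⟩
    obtain ⟨x, hx⟩ := LieIdeal.mem_map_of_surjective hf hy
    exact ⟨x, Subtype.ext hx⟩
  have := hg.lieAlgebra_isSolvable
  exact HasTrivialRadical.eq_bot_of_isSolvable _

/-- A split central extension of a semisimple Lie algebra is reductive. -/
theorem isReductive_of_isCompl_ker [CharZero k] [FiniteDimensional k L] [HasTrivialRadical k G]
    (f : L →ₗ⁅k⁆ G) (hf : Function.Surjective f) (hc : f.ker ≤ center k L)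
    (S : LieIdeal k L) (h : IsCompl S f.ker) : IsReductive k L ∧ HasCentralRadical k L := by
  have : FiniteDimensional k G := Module.Finite.of_surjective (f : L →ₗ[k] G) hf
  refine ⟨⟨S, f.ker, h, ?_, ⟨fun x y => ?_⟩⟩,
    hasCentralRadical_of_radical_le k L ((radical_le_ker f hf).trans hc)⟩
  -- By Cartan's criterion `G` has nondegenerate Killing form; this passes to `S` along the
  -- isomorphism and forces its radical to vanish.
  · have := isKilling_of_equiv (equivOfIsComplKer f hf S h).symm
    infer_instance
  · exact Subtype.ext (hc y.2 x)

end Complement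

/-! ### A Leibniz algebra as a module over its Lie quotient. -/

section Module

variable (k L : Type*) [CommRing k] [LeftLeibnizRing L] [LeftLeibnizAlgebra k L]

/-- Left multiplication as a bilinear map. -/
def leftMul : L →ₗ[k] L →ₗ[k] L :=
  LinearMap.mk₂ k (fun x y => ⁅x, y⁆) LeftLeibnizRing.add_lie LeftLeibnizAlgebra.smul_lie
    LeftLeibnizRing.lie_add LeftLeibnizAlgebra.lie_smul

/-- A left Leibniz algebra is a module over its quotient by the left center. -/
@[reducible] def quotientLieRingModule : LieRingModule (L ⧸ leftCenter k L) L where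
  bracket q m := (leftCenter k L).liftQ (leftMul k L) (fun _ hx => LinearMap.ext hx) q m
  add_lie x y m := by rw [map_add, LinearMap.add_apply]
  lie_add x m n := map_add _ m n
  leibniz_lie x y m := by
    induction x using Submodule.Quotient.induction_on with | _ x
    induction y using Submodule.Quotient.induction_on with | _ y
    exact LeftLeibnizRing.leibniz_lie x y m

attribute [local instance] quotientLieRingModule

theorem quotientLieModule : LieModule k (L ⧸ leftCenter k L) L where
  smul_lie t x m := by
    induction x using Submodule.Quotient.induction_on with | _ x
    exact LeftLeibnizAlgebra.smul_lie t x m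
  lie_smul t x m := by
    induction x using Submodule.Quotient.induction_on with | _ x
    exact LeftLeibnizAlgebra.lie_smul t x m

/-- The quotient map is a homomorphism of modules over the quotient. -/
def mkModuleHom : L →ₗ⁅k, L ⧸ leftCenter k L⁆ (L ⧸ leftCenter k L) where
  toLinearMap := (leftCenter k L).mkQ
  map_lie' {x m} := by
    induction x using Submodule.Quotient.induction_on with | _ x
    rfl

end Module

attribute [local instance] quotientLieRingModule quotientLieModule in
/-- If the left center is contained in the right center and the quotient by it is semisimple,
then there is an equivariant projection along the left center. -/
theorem exists_equivariant_projection (k L : Type*) [Field k] [CharZero k] [LeftLeibnizRing L]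
    [LeftLeibnizAlgebra k L] [FiniteDimensional k L] (hcenter : leftCenter k L ≤ rightCenter k L)
    (hss : LieAlgebra.HasTrivialRadical k (L ⧸ leftCenter k L)) :
    ∃ C : L →ₗ[k] L, (∀ x y : L, ⁅x, C y⁆ = C ⁅x, y⁆) ∧ (∀ x ∈ leftCenter k L, C x = 0) ∧
      ∀ x, x - C x ∈ leftCenter k L := by
  let b := Module.finBasis k (L ⧸ leftCenter k L)
  refine ⟨casimir L b, fun x y => ?_, fun x hx => ?_, fun x => ?_⟩
  · exact lie_casimir b (Submodule.Quotient.mk x) y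
  · rw [casimir_apply]
    refine Finset.sum_eq_zero fun i _ => ?_
    have h (q : L ⧸ leftCenter k L) : ⁅q, x⁆ = 0 := by
      induction q using Submodule.Quotient.induction_on with | _ q
      exact hcenter hx q
    rw [h, lie_zero]
  · rw [← Submodule.Quotient.mk_eq_zero, Submodule.Quotient.mk_sub, sub_eq_zero]
    -- The quotient map intertwines the Casimir operators on `L` and on the adjoint module, and the
    -- latter is the identity.
    exact ((map_casimir b (mkModuleHom k L) x).trans (casimir_adjoint b _)).symm

end LeftLeibniz

open LeftLeibniz in
theorem corollary7 (k L : Type*) [Field k] [CharZero k] [LeftLeibnizRing L]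
    [LeftLeibnizAlgebra k L] [FiniteDimensional k L]
    (hcenter : LeftLeibniz.leftCenter k L ≤ LeftLeibniz.rightCenter k L)
    (hss : LieAlgebra.HasTrivialRadical k (L ⧸ LeftLeibniz.leftCenter k L)) :
    ∃ h : LeftLeibniz.IsLie L,
      letI : LieRing L := h.toLieRing
      letI : LieAlgebra k L := h.toLieAlgebra k
      LeftLeibniz.IsReductive k L ∧ LieAlgebra.HasCentralRadical k L := by
  obtain ⟨C, hC, hC₀, hC₁⟩ := exists_equivariant_projection k L hcenter hss
  have h : IsLie L := fun x => by
    have h₁ : ⁅x, x - C x⁆ = 0 := hcenter (hC₁ x) x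
    rw [sub_eq_add_neg, LeftLeibnizRing.lie_add, bracket_neg, hC,
      hC₀ _ (self_bracket_mem_leftCenter x), neg_zero, add_zero] at h₁
    exact h₁
  refine ⟨h, ?_⟩
  let : LieRing L := h.toLieRing
  let : LieAlgebra k L := h.toLieAlgebra k
  let f : L →ₗ⁅k⁆ (L ⧸ leftCenter k L) :=
    { toLinearMap := (leftCenter k L).mkQ
      map_lie' := rfl }
  have hker (x : L) : x ∈ f.ker ↔ x ∈ leftCenter k L :=
    LieHom.mem_ker.trans (Submodule.Quotient.mk_eq_zero _)
  let S : LieIdeal k L :=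
    { toSubmodule := LinearMap.range C
      lie_mem := by
        rintro x _ ⟨y, rfl⟩
        exact ⟨⁅x, y⁆, (hC x y).symm⟩ }
  refine isReductive_of_isCompl_ker f (Submodule.mkQ_surjective _) (fun x hx y => ?_) S ⟨?_, ?_⟩
  · exact hcenter ((hker x).mp hx) y
  · rw [disjoint_iff, eq_bot_iff]
    rintro _ ⟨⟨y, rfl⟩, hy⟩
    -- `C` kills both `C y`, which lies in the kernel, and `y - C y`; hence it kills `y`.
    have h₁ := hC₀ _ ((hker _).mp hy)
    have h₂ := hC₀ _ (hC₁ y)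
    rw [map_sub, h₁, sub_zero] at h₂
    exact h₂
  · rw [codisjoint_iff, eq_top_iff]
    intro x _
    exact (LieSubmodule.mem_sup _ _ _).mpr
      ⟨C x, ⟨x, rfl⟩, x - C x, (hker _).mpr (hC₁ x), add_sub_cancel _ _⟩
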